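/- Let $k$ be an algebraically closed field of characteristic zero, $A$ a finitely generated associative $k$-algebra and $E$ an indecomposable left $A$-module of finite dimension $n$ over $k$ with $\mathrm{End}_A(E)\cong k$. For commutative local artinian $k$-algebras $R$ with residue field $k$, let $\mathrm{Def}_E(R)$ be the set of isomorphism classes of liftings of $E$ to an $A\otimes_k R$-module structure on $E\otimes_k R$; for a short exact sequence of $A$-modules $\xi:\ 0\to M\to E\to N\to 0$, let $\mathrm{Def}_\xi(R)$ be the set of isomorphism classes of short exact sequences $0\to M\otimes_k R\to E\otimes_k R\to N\otimes_k R\to 0$ of $A\otimes_k R$-modules lifting $\xi$. Let $H(E)$ and $H(\xi)$ be the formal moduli (complete local noetherian commutative $k$-algebras with residue field $k$ that are pro-representing hulls) of these functors, and let $\tilde\xi: H(E)\to H(\xi)$ be a map inducing the forgetful morphism $\mathrm{Def}_\xi\to\mathrm{Def}_E$. Suppose that $E$ is a smooth completion point of $\mathrm{Simp}_n(A)$, that is, for every non-split short exact sequence $\xi:\ 0\to M\to E\to N\to 0$ the map $\mathfrak m_{H(E)}/\mathfrak m_{H(E)}^2\to \mathfrak m_{H(\xi)}/\mathfrak m_{H(\xi)}^2$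 induced by $\tilde\xi$ is not injective. Let $0=E_0\subset E_1\subset\dots\subset E_r=E$ be any composition series of $E$, with simple factors $V_i=E_i/E_{i-1}$, $i=1,\dots,r$, and consider the extension graph: the directed graph with vertices $V_1,\dots,V_r$ and an arrow from $V_i$ to $V_j$ if and only if $\mathrm{Ext}^1_A(V_i,V_j)\neq 0$. Then this graph has a complete cycle, i.e. a directed path that starts and ends at the same vertex and contains all the vertices (when there is only one vertex, the path of length $0$ is allowed). -/

import Mathlib

open CategoryTheory TensorProduct

universe u

namespace Completion

/-! ### Pointed local algebras -/

/-- Two `k`-algebra maps from a local `k`-algebra to `k` agree: their common kernel is the maximal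
ideal. -/
theorem point_unique {k R : Type u} [Field k] [CommRing R] [Algebra k R] [IsLocalRing R]
    (p q : R →ₐ[k] k) : p = q := by
  ext x
  have hp : p (x - algebraMap k R (p x)) = 0 := by simp
  have hnu : ¬ IsUnit (x - algebraMap k R (p x)) := fun h => by
    have := h.map p
    rw [hp] at this
    exact not_isUnit_zero this
  have hq : q (x - algebraMap k R (p x)) = 0 := by
    by_contra hne
    have hmem : (x - algebraMap k R (p x)) ∈ IsLocalRing.maximalIdeal R := hnu
    have hs : Function.Surjective q := fun c => ⟨algebraMap k R c, by simp⟩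
    have hmax : (RingHom.ker (q : R →+* k)).IsMaximal :=
      RingHom.ker_isMaximal_of_surjective (q : R →+* k) hs
    rw [← IsLocalRing.eq_maximalIdeal hmax] at hmem
    exact hne hmem
  have : q x - p x = 0 := by simpa using hq
  exact (sub_eq_zero.mp this).symm

/-- Commutative local artinian `k`-algebras with residue field `k`, pointed by the residue map
`R → k`. (Such algebras are finite dimensional over `k`, so the universe of `k` suffices.) -/
structure ArtAlg (k : Type u) [Field k] : Type (u + 1) where
  carrier : Type u
  [commRing : CommRing carrier]
  [algebra : Algebra k carrier]
  [isLocalRing : IsLocalRing carrier]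
  [isArtinianRing : IsArtinianRing carrier]
  point : carrier →ₐ[k] k

attribute [instance] ArtAlg.commRing ArtAlg.algebra ArtAlg.isLocalRing ArtAlg.isArtinianRing

/-- Morphisms are the `k`-algebra maps; they respect the points by `point_unique`. -/
instance ArtAlg.category (k : Type u) [Field k] : Category.{u} (ArtAlg k) where
  Hom R S := R.carrier →ₐ[k] S.carrier
  id R := AlgHom.id k R.carrier
  comp f g := AlgHom.comp g f

/-- The `k`-algebra map underlying a morphism. -/
def ArtAlg.toAlgHom {k : Type u} [Field k] {R S : ArtAlg k} (f : R ⟶ S) :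
    R.carrier →ₐ[k] S.carrier := f

/-- The dual numbers `k[ε]`. -/
noncomputable def ArtAlg.dualNumbers (k : Type u) [Field k] : ArtAlg k :=
  haveI : IsArtinianRing (DualNumber k) :=
    haveI : Module.Finite k (DualNumber k) := inferInstanceAs (Module.Finite k (k × k))
    IsArtinianRing.of_finite k (DualNumber k)
  { carrier := DualNumber k
    point := TrivSqZeroExt.fstHom k k k }

/-- Formal `k`-algebras: complete local noetherian commutative `k`-algebras with residue
field `k`. -/
structure FormalAlg (k : Type u) [Field k] : Type (u + 1) where
  carrier : Type u
  [commRing : CommRing carrier]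
  [algebra : Algebra k carrier]
  [isLocalRing : IsLocalRing carrier]
  [isNoetherianRing : IsNoetherianRing carrier]
  [isAdicComplete : IsAdicComplete (IsLocalRing.maximalIdeal carrier) carrier]
  point : carrier →ₐ[k] k

attribute [instance] FormalAlg.commRing FormalAlg.algebra FormalAlg.isLocalRing
  FormalAlg.isNoetherianRing FormalAlg.isAdicComplete

/-- A `k`-algebra map of formal `k`-algebras is local. -/
theorem FormalAlg.maximalIdeal_le_comap {k : Type u} [Field k] {H K : FormalAlg k}
    (h : H.carrier →ₐ[k] K.carrier) :
    IsLocalRing.maximalIdeal H.carrier ≤ (IsLocalRing.maximalIdeal K.carrier).comap h := by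
  intro x hx
  have key : ∀ L : FormalAlg k,
      RingHom.ker (L.point : L.carrier →+* k) = IsLocalRing.maximalIdeal L.carrier := fun L =>
    IsLocalRing.eq_maximalIdeal (RingHom.ker_isMaximal_of_surjective (L.point : L.carrier →+* k)
      fun c => ⟨algebraMap k L.carrier c, by simp⟩)
  rw [← key H] at hx
  rw [Ideal.mem_comap, ← key K]
  have h1 : (K.point.comp h) x = H.point x := by rw [point_unique (K.point.comp h) H.point]
  have h2 : H.point x = 0 := hx
  have h3 : K.point (h x) = 0 := h1.trans h2
  exact h3

/-- The map `𝔪_H / 𝔪_H² → 𝔪_K / 𝔪_K²` induced by a map `H → K` of formal `k`-algebras. -/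
noncomputable def FormalAlg.cotangentMap {k : Type u} [Field k] {H K : FormalAlg k}
    (h : H.carrier →ₐ[k] K.carrier) :
    (IsLocalRing.maximalIdeal H.carrier).Cotangent →ₗ[k]
      (IsLocalRing.maximalIdeal K.carrier).Cotangent :=
  Ideal.mapCotangent _ _ h (FormalAlg.maximalIdeal_le_comap h)

/-- The functor `R ↦ Hom(H, R)` on artinian algebras pro-represented by a formal algebra `H`. -/
def FormalAlg.homFunctor {k : Type u} [Field k] (H : FormalAlg k) : ArtAlg k ⥤ Type u where
  obj R := H.carrier →ₐ[k] R.carrier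
  map f := ↾(fun φ => (ArtAlg.toAlgHom f).comp φ)

/-- Precomposition with a map `H → K` of formal algebras. -/
def FormalAlg.homFunctorMap {k : Type u} [Field k] {H K : FormalAlg k}
    (h : H.carrier →ₐ[k] K.carrier) : K.homFunctor ⟶ H.homFunctor where
  app R := ↾(fun φ : K.carrier →ₐ[k] R.carrier => φ.comp h)

/-- A formal moduli (pro-representing hull) of a functor `D` on artinian algebras: a formal
algebra `H` with a versal family, i.e. a smooth morphism `Hom(H, -) ⟶ D` which is bijective on
tangent spaces. -/
structure FormalModuli {k : Type u} [Field k] (D : ArtAlg k ⥤ Type u) : Type (u + 1) where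
  alg : FormalAlg k
  family : alg.homFunctor ⟶ D
  smooth : ∀ {R S : ArtAlg k} (f : R ⟶ S), Function.Surjective (ArtAlg.toAlgHom f) →
    ∀ (φ : alg.homFunctor.obj S) (d : D.obj R), D.map f d = family.app S φ →
      ∃ ψ : alg.homFunctor.obj R, alg.homFunctor.map f ψ = φ ∧ family.app R ψ = d
  tangent : Function.Bijective (family.app (ArtAlg.dualNumbers k))

/-! ### Base change of linear maps between the modules `R ⊗ X` -/

section BaseChange

variable {k : Type u} [Field k] {R S T : Type u} [CommRing R] [Algebra k R] [CommRing S]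
  [Algebra k S] [CommRing T] [Algebra k T] {X Y Z : Type u} [AddCommGroup X] [Module k X]
  [AddCommGroup Y] [Module k Y] [AddCommGroup Z] [Module k Z]

/-- Base change along `f : R → S` of an `R`-linear map `R ⊗ X → R ⊗ Y`: the `S`-linear map
`S ⊗ X → S ⊗ Y` compatible with `g` via `f ⊗ 1`. -/
noncomputable def baseChange (f : R →ₐ[k] S) (g : R ⊗[k] X →ₗ[R] R ⊗[k] Y) :
    S ⊗[k] X →ₗ[S] S ⊗[k] Y :=
  LinearMap.liftBaseChange S
    ((f.toLinearMap.rTensor Y) ∘ₗ (g.restrictScalars k) ∘ₗ (TensorProduct.mk k R X 1))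

theorem rTensor_smul (f : R →ₐ[k] S) (r : R) (z : R ⊗[k] X) :
    f.toLinearMap.rTensor X (r • z) = f r • f.toLinearMap.rTensor X z := by
  induction z with
  | zero => simp
  | tmul a x => simp [TensorProduct.smul_tmul']
  | add a b ha hb => simp [ha, hb]

theorem baseChange_rTensor (f : R →ₐ[k] S) (g : R ⊗[k] X →ₗ[R] R ⊗[k] Y) (z : R ⊗[k] X) :
    baseChange f g (f.toLinearMap.rTensor X z) = f.toLinearMap.rTensor Y (g z) := by
  induction z with
  | zero => simp
  | tmul r x =>
    have h : r ⊗ₜ[k] x = r • ((1 : R) ⊗ₜ[k] x) := by simp [TensorProduct.smul_tmul']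
    rw [h, rTensor_smul, map_smul g, rTensor_smul, map_smul (baseChange f g)]
    simp [baseChange]
  | add a b ha hb => simp [ha, hb]

/-- An `S`-linear map out of `S ⊗ X` is determined on the image of `f ⊗ 1`. -/
theorem ext_rTensor (f : R →ₐ[k] S) {g h : S ⊗[k] X →ₗ[S] S ⊗[k] Y}
    (H : ∀ z : R ⊗[k] X, g (f.toLinearMap.rTensor X z) = h (f.toLinearMap.rTensor X z)) :
    g = h := by
  apply TensorProduct.AlgebraTensorModule.curry_injective
  ext x
  simpa using H (1 ⊗ₜ x)

theorem baseChange_unique (f : R →ₐ[k] S) (g : R ⊗[k] X →ₗ[R] R ⊗[k] Y)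
    (h : S ⊗[k] X →ₗ[S] S ⊗[k] Y)
    (H : ∀ z, h (f.toLinearMap.rTensor X z) = f.toLinearMap.rTensor Y (g z)) :
    baseChange f g = h :=
  ext_rTensor f fun z => by rw [baseChange_rTensor, H]

theorem baseChange_id (g : R ⊗[k] X →ₗ[R] R ⊗[k] Y) : baseChange (AlgHom.id k R) g = g :=
  baseChange_unique _ _ _ fun z => by simp

theorem baseChange_one (f : R →ₐ[k] S) :
    baseChange f (LinearMap.id : R ⊗[k] X →ₗ[R] R ⊗[k] X) = LinearMap.id :=
  baseChange_unique _ _ _ fun z => by simp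

theorem baseChange_comp (f : R →ₐ[k] S) (g : R ⊗[k] Y →ₗ[R] R ⊗[k] Z)
    (h : R ⊗[k] X →ₗ[R] R ⊗[k] Y) :
    baseChange f (g ∘ₗ h) = baseChange f g ∘ₗ baseChange f h :=
  baseChange_unique _ _ _ fun z => by simp [baseChange_rTensor]

theorem baseChange_add (f : R →ₐ[k] S) (g h : R ⊗[k] X →ₗ[R] R ⊗[k] Y) :
    baseChange f (g + h) = baseChange f g + baseChange f h :=
  baseChange_unique _ _ _ fun z => by simp [baseChange_rTensor]

theorem baseChange_zero (f : R →ₐ[k] S) :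
    baseChange f (0 : R ⊗[k] X →ₗ[R] R ⊗[k] Y) = 0 :=
  baseChange_unique _ _ _ fun z => by simp

theorem baseChange_baseChange (f : R →ₐ[k] S) (f' : S →ₐ[k] T) (g : R ⊗[k] X →ₗ[R] R ⊗[k] Y) :
    baseChange (f'.comp f) g = baseChange f' (baseChange f g) := by
  apply baseChange_unique
  intro z
  have e : ∀ (W : Type u) [AddCommGroup W] [Module k W] (w : R ⊗[k] W),
      (f'.comp f).toLinearMap.rTensor W w =
        f'.toLinearMap.rTensor W (f.toLinearMap.rTensor W w) := by
    intro W _ _ w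
    rw [AlgHom.comp_toLinearMap, LinearMap.rTensor_comp_apply]
  rw [e, e, baseChange_rTensor, baseChange_rTensor]

/-- Base change preserves short exact sequences `0 → R ⊗ X → R ⊗ Y → R ⊗ Z → 0`
(they split, as `R ⊗ Z` is free). -/
theorem baseChange_exact (f : R →ₐ[k] S) (i : R ⊗[k] X →ₗ[R] R ⊗[k] Y)
    (p : R ⊗[k] Y →ₗ[R] R ⊗[k] Z) (hi : Function.Injective i) (hip : Function.Exact i p)
    (hp : Function.Surjective p) :
    Function.Injective (baseChange f i) ∧ Function.Exact (baseChange f i) (baseChange f p) ∧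
      Function.Surjective (baseChange f p) := by
  obtain ⟨s, hs⟩ := Module.projective_lifting_property p LinearMap.id hp
  have hs' : ∀ z, p (s z) = z := fun z => LinearMap.congr_fun hs z
  have hex : ∀ y, ∃ x, i x = y - s (p y) := fun y => (hip _).1 (by simp [hs'])
  choose r0 hr0 using hex
  let r : R ⊗[k] Y →ₗ[R] R ⊗[k] X :=
    { toFun := r0
      map_add' := fun a b => hi (by simp only [hr0, map_add]; abel)
      map_smul' := fun c a => hi (by simp only [hr0, map_smul, RingHom.id_apply, smul_sub]) }
  have hr : ∀ y, i (r y) = y - s (p y) := hr0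
  have h1 : r ∘ₗ i = LinearMap.id := by
    refine LinearMap.ext fun x => hi ?_
    simp [hr, (hip _).2 ⟨x, rfl⟩]
  have h2 : i ∘ₗ r + s ∘ₗ p = LinearMap.id := LinearMap.ext fun y => by simp [hr]
  have h3 : p ∘ₗ i = 0 := LinearMap.ext fun x => (hip _).2 ⟨x, rfl⟩
  have k1 := congrArg (baseChange f) h1
  have k2 := congrArg (baseChange f) h2
  have k3 := congrArg (baseChange f) h3
  have k4 := congrArg (baseChange f) hs
  rw [baseChange_comp, baseChange_one] at k1 k4
  rw [baseChange_add, baseChange_comp, baseChange_comp, baseChange_one] at k2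
  rw [baseChange_comp, baseChange_zero] at k3
  refine ⟨?_, ?_, ?_⟩
  · exact Function.LeftInverse.injective (g := baseChange f r) fun x => LinearMap.congr_fun k1 x
  · intro y
    constructor
    · intro hy
      have := LinearMap.congr_fun k2 y
      simp only [LinearMap.add_apply, LinearMap.comp_apply, hy, map_zero, add_zero,
        LinearMap.id_apply] at this
      exact ⟨_, this⟩
    · rintro ⟨x, rfl⟩
      exact LinearMap.congr_fun k3 x
  · exact Function.RightInverse.surjective (g := baseChange f s) fun x => LinearMap.congr_fun k4 x

/-- Base change as an algebra map of endomorphism rings. -/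
noncomputable def baseChangeEnd (X : Type u) [AddCommGroup X] [Module k X] (f : R →ₐ[k] S) :
    Module.End R (R ⊗[k] X) →ₐ[k] Module.End S (S ⊗[k] X) where
  toFun g := baseChange f g
  map_one' := baseChange_one f
  map_mul' g h := baseChange_comp f g h
  map_zero' := baseChange_zero f
  map_add' g h := baseChange_add f g h
  commutes' c := baseChange_unique _ _ _ fun z => by simp [Module.algebraMap_end_apply]

/-- Base change of automorphisms. -/
noncomputable def baseChangeEquiv (f : R →ₐ[k] S) (g : R ⊗[k] X ≃ₗ[R] R ⊗[k] X) :
    S ⊗[k] X ≃ₗ[S] S ⊗[k] X :=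
  LinearEquiv.ofLinearMap (baseChange f g) (baseChange f g.symm)
    (by rw [← baseChange_comp, ← baseChange_one f]; congr 1; ext; simp)
    (by rw [← baseChange_comp, ← baseChange_one f]; congr 1; ext; simp)

end BaseChange

/-! ### The deformation functor of a module -/

/-- Reduction `R ⊗ X → k ⊗ X ≃ X` modulo the maximal ideal. -/
noncomputable def reduce {k : Type u} [Field k] (R : ArtAlg k) (X : Type u) [AddCommGroup X]
    [Module k X] : R.carrier ⊗[k] X →ₗ[k] X :=
  (TensorProduct.lid k X).toLinearMap ∘ₗ R.point.toLinearMap.rTensor X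

theorem reduce_rTensor {k : Type u} [Field k] {R S : ArtAlg k} (f : R.carrier →ₐ[k] S.carrier)
    {X : Type u} [AddCommGroup X] [Module k X] (z : R.carrier ⊗[k] X) :
    reduce S X (f.toLinearMap.rTensor X z) = reduce R X z := by
  simp only [reduce, LinearMap.comp_apply, ← LinearMap.rTensor_comp_apply]
  rw [← AlgHom.comp_toLinearMap, point_unique (S.point.comp f) R.point]

theorem reduce_smul {k : Type u} [Field k] (R : ArtAlg k) {X : Type u} [AddCommGroup X]
    [Module k X] (r : R.carrier) (z : R.carrier ⊗[k] X) :
    reduce R X (r • z) = R.point r • reduce R X z := by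
  simp [reduce, rTensor_smul]

/-- Compatibility of an `R`-linear map with its reduction passes to base changes. -/
theorem reduce_baseChange {k : Type u} [Field k] {R S : ArtAlg k}
    (f : R.carrier →ₐ[k] S.carrier) {X Y : Type u} [AddCommGroup X] [Module k X]
    [AddCommGroup Y] [Module k Y] (g : R.carrier ⊗[k] X →ₗ[R.carrier] R.carrier ⊗[k] Y)
    (g₀ : X →ₗ[k] Y) (h : ∀ z, reduce R Y (g z) = g₀ (reduce R X z)) (z : S.carrier ⊗[k] X) :
    reduce S Y (baseChange f g z) = g₀ (reduce S X z) := by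
  induction z with
  | zero => simp
  | tmul s x =>
    have e : s ⊗ₜ[k] x = s • f.toLinearMap.rTensor X ((1 : R.carrier) ⊗ₜ[k] x) := by
      simp [TensorProduct.smul_tmul']
    rw [e, map_smul, reduce_smul, reduce_smul, baseChange_rTensor, reduce_rTensor, h,
      reduce_rTensor, map_smul]
  | add a b ha hb => simp [ha, hb]

/-- A lifting of the `A`-module `E` to `R`: an `R`-linear `A`-module structure on `R ⊗ E`, that is,
an algebra map `A → End_R(R ⊗ E)`, which reduces to the given structure on `E`. -/
@[ext]
structure ModuleLift {k : Type u} [Field k] (A : Type u) [Ring A] [Algebra k A] (E : Type u)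
    [AddCommGroup E] [Module k E] [Module A E] [IsScalarTower k A E] (R : ArtAlg k) :
    Type u where
  act : A →ₐ[k] Module.End R.carrier (R.carrier ⊗[k] E)
  reduce_act : ∀ a z, reduce R E (act a z) = a • reduce R E z

section Module

variable {k : Type u} [Field k] {A : Type u} [Ring A] [Algebra k A] {E : Type u}
  [AddCommGroup E] [Module k E] [Module A E] [IsScalarTower k A E]

/-- Base change of a lifting. -/
noncomputable def ModuleLift.map {R S : ArtAlg k} (f : R.carrier →ₐ[k] S.carrier)
    (L : ModuleLift A E R) : ModuleLift A E S where
  act := (baseChangeEnd E f).comp L.act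
  reduce_act a z := reduce_baseChange f (L.act a) (Algebra.lsmul k k E a) (L.reduce_act a) z

/-- `g` is an isomorphism of liftings: it is `R`-linear, `A`-linear, and reduces to the identity
of `E`. -/
def ModuleLift.IsIso {R : ArtAlg k} (L L' : ModuleLift A E R)
    (g : R.carrier ⊗[k] E ≃ₗ[R.carrier] R.carrier ⊗[k] E) : Prop :=
  (∀ z, reduce R E (g z) = reduce R E z) ∧ ∀ a z, g (L.act a z) = L'.act a (g z)

theorem ModuleLift.IsIso.refl {R : ArtAlg k} (L : ModuleLift A E R) :
    L.IsIso L (LinearEquiv.refl _ _) := ⟨fun _ => rfl, fun _ _ => rfl⟩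

theorem ModuleLift.IsIso.symm {R : ArtAlg k} {L L' : ModuleLift A E R}
    {g : R.carrier ⊗[k] E ≃ₗ[R.carrier] R.carrier ⊗[k] E} (h : L.IsIso L' g) :
    L'.IsIso L g.symm :=
  ⟨fun z => by rw [← h.1, g.apply_symm_apply],
    fun a z => g.injective (by rw [h.2, g.apply_symm_apply, g.apply_symm_apply])⟩

theorem ModuleLift.IsIso.trans {R : ArtAlg k} {L L' L'' : ModuleLift A E R}
    {g g' : R.carrier ⊗[k] E ≃ₗ[R.carrier] R.carrier ⊗[k] E} (h : L.IsIso L' g)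
    (h' : L'.IsIso L'' g') : L.IsIso L'' (g.trans g') :=
  ⟨fun z => by simp [h'.1, h.1], fun a z => by simp [h.2, h'.2]⟩

theorem ModuleLift.IsIso.map {R S : ArtAlg k} (f : R.carrier →ₐ[k] S.carrier)
    {L L' : ModuleLift A E R} {g : R.carrier ⊗[k] E ≃ₗ[R.carrier] R.carrier ⊗[k] E}
    (h : L.IsIso L' g) : (L.map f).IsIso (L'.map f) (baseChangeEquiv f g) := by
  refine ⟨fun z => ?_, fun a z => ?_⟩
  · exact reduce_baseChange f g.toLinearMap LinearMap.id h.1 z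
  · have e : g.toLinearMap ∘ₗ L.act a = L'.act a ∘ₗ g.toLinearMap :=
      LinearMap.ext fun z => h.2 a z
    have e' := congrArg (baseChange f) e
    rw [baseChange_comp, baseChange_comp] at e'
    exact LinearMap.congr_fun e' z

variable (A E) in
/-- Liftings are identified when they are isomorphic. -/
def ModuleLift.setoid (R : ArtAlg k) : Setoid (ModuleLift A E R) where
  r L L' := ∃ g, L.IsIso L' g
  iseqv := ⟨fun L => ⟨_, .refl L⟩, fun ⟨_, h⟩ => ⟨_, h.symm⟩, fun ⟨_, h⟩ ⟨_, h'⟩ => ⟨_, h.trans h'⟩⟩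

variable (k A E) in
/-- The deformation functor `Def_E`. -/
noncomputable def defModule : ArtAlg k ⥤ Type u where
  obj R := Quotient (ModuleLift.setoid A E R)
  map {R S} f := ↾(Quotient.map (sa := ModuleLift.setoid A E R) (sb := ModuleLift.setoid A E S)
    (ModuleLift.map (ArtAlg.toAlgHom f)) (fun _ _ ⟨_, h⟩ => ⟨_, h.map _⟩))
  map_id R := by
    ext x
    induction x using Quotient.inductionOn with
    | h L =>
      refine congrArg _ (ModuleLift.ext (AlgHom.ext fun a => ?_))
      exact baseChange_id (L.act a)
  map_comp f g := by
    ext x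
    induction x using Quotient.inductionOn with
    | h L =>
      refine congrArg _ (ModuleLift.ext (AlgHom.ext fun a => ?_))
      exact baseChange_baseChange (ArtAlg.toAlgHom f) (ArtAlg.toAlgHom g) (L.act a)

end Module

/-! ### The deformation functor of a short exact sequence -/

/-- A lifting to `R` of the sequence `M → E → N` with maps `ι`, `π`: liftings of the three modules
and a short exact sequence `0 → R ⊗ M → R ⊗ E → R ⊗ N → 0` of maps which are `R`-linear, `A`-linear
and reduce to `ι` and `π`. -/
@[ext]
structure SeqLift {k : Type u} [Field k] {A : Type u} [Ring A] [Algebra k A] {M E N : Type u}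
    [AddCommGroup M] [Module k M] [Module A M] [IsScalarTower k A M]
    [AddCommGroup E] [Module k E] [Module A E] [IsScalarTower k A E]
    [AddCommGroup N] [Module k N] [Module A N] [IsScalarTower k A N]
    (ι : M →ₗ[A] E) (π : E →ₗ[A] N) (R : ArtAlg k) : Type u where
  sub : ModuleLift A M R
  mid : ModuleLift A E R
  quot : ModuleLift A N R
  incl : R.carrier ⊗[k] M →ₗ[R.carrier] R.carrier ⊗[k] E
  proj : R.carrier ⊗[k] E →ₗ[R.carrier] R.carrier ⊗[k] N
  incl_act : ∀ a z, incl (sub.act a z) = mid.act a (incl z)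
  proj_act : ∀ a z, proj (mid.act a z) = quot.act a (proj z)
  reduce_incl : ∀ z, reduce R E (incl z) = ι (reduce R M z)
  reduce_proj : ∀ z, reduce R N (proj z) = π (reduce R E z)
  incl_injective : Function.Injective incl
  exact : Function.Exact incl proj
  proj_surjective : Function.Surjective proj

section Seq

variable {k : Type u} [Field k] {A : Type u} [Ring A] [Algebra k A] {M E N : Type u}
  [AddCommGroup M] [Module k M] [Module A M] [IsScalarTower k A M]
  [AddCommGroup E] [Module k E] [Module A E] [IsScalarTower k A E]
  [AddCommGroup N] [Module k N] [Module A N] [IsScalarTower k A N]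
  {ι : M →ₗ[A] E} {π : E →ₗ[A] N}

/-- Base change of a lifting of a sequence. -/
noncomputable def SeqLift.map {R S : ArtAlg k} (f : R.carrier →ₐ[k] S.carrier)
    (L : SeqLift ι π R) : SeqLift ι π S where
  sub := L.sub.map f
  mid := L.mid.map f
  quot := L.quot.map f
  incl := baseChange f L.incl
  proj := baseChange f L.proj
  incl_act a z := by
    have e : L.incl ∘ₗ L.sub.act a = L.mid.act a ∘ₗ L.incl := LinearMap.ext (L.incl_act a)
    have e' := congrArg (baseChange f) e
    rw [baseChange_comp, baseChange_comp] at e'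
    exact LinearMap.congr_fun e' z
  proj_act a z := by
    have e : L.proj ∘ₗ L.mid.act a = L.quot.act a ∘ₗ L.proj := LinearMap.ext (L.proj_act a)
    have e' := congrArg (baseChange f) e
    rw [baseChange_comp, baseChange_comp] at e'
    exact LinearMap.congr_fun e' z
  reduce_incl z := reduce_baseChange f L.incl (ι.restrictScalars k) L.reduce_incl z
  reduce_proj z := reduce_baseChange f L.proj (π.restrictScalars k) L.reduce_proj z
  incl_injective :=
    (baseChange_exact f _ _ L.incl_injective L.exact L.proj_surjective).1
  exact := (baseChange_exact f _ _ L.incl_injective L.exact L.proj_surjective).2.1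
  proj_surjective :=
    (baseChange_exact f _ _ L.incl_injective L.exact L.proj_surjective).2.2

/-- Isomorphisms of liftings of a sequence. -/
def SeqLift.IsIso {R : ArtAlg k} (L L' : SeqLift ι π R)
    (g : (R.carrier ⊗[k] M ≃ₗ[R.carrier] R.carrier ⊗[k] M) ×
      (R.carrier ⊗[k] E ≃ₗ[R.carrier] R.carrier ⊗[k] E) ×
      (R.carrier ⊗[k] N ≃ₗ[R.carrier] R.carrier ⊗[k] N)) : Prop :=
  L.sub.IsIso L'.sub g.1 ∧ L.mid.IsIso L'.mid g.2.1 ∧ L.quot.IsIso L'.quot g.2.2 ∧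
    (∀ z, g.2.1 (L.incl z) = L'.incl (g.1 z)) ∧ ∀ z, g.2.2 (L.proj z) = L'.proj (g.2.1 z)

variable (ι π) in
/-- Liftings of a sequence are identified when they are isomorphic. -/
def SeqLift.setoid (R : ArtAlg k) : Setoid (SeqLift ι π R) where
  r L L' := ∃ g, L.IsIso L' g
  iseqv :=
    { refl := fun L => ⟨⟨_, _, _⟩, .refl _, .refl _, .refl _, fun _ => rfl, fun _ => rfl⟩
      symm := by
        rintro L L' ⟨g, h1, h2, h3, h4, h5⟩
        refine ⟨⟨_, _, _⟩, h1.symm, h2.symm, h3.symm, fun z => g.2.1.injective ?_,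
          fun z => g.2.2.injective ?_⟩
        · simp [h4]
        · simp [h5]
      trans := by
        rintro L L' L'' ⟨g, h1, h2, h3, h4, h5⟩ ⟨g', h1', h2', h3', h4', h5'⟩
        exact ⟨⟨_, _, _⟩, h1.trans h1', h2.trans h2', h3.trans h3', fun z => by simp [h4, h4'],
          fun z => by simp [h5, h5']⟩ }

theorem SeqLift.map_equiv {R S : ArtAlg k} (f : R.carrier →ₐ[k] S.carrier)
    (L L' : SeqLift ι π R) (h : (SeqLift.setoid ι π R).r L L') :
    (SeqLift.setoid ι π S).r (L.map f) (L'.map f) := by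
  obtain ⟨g, h1, h2, h3, h4, h5⟩ := h
  refine ⟨⟨_, _, _⟩, h1.map f, h2.map f, h3.map f, fun z => ?_, fun z => ?_⟩
  · have e : g.2.1.toLinearMap ∘ₗ L.incl = L'.incl ∘ₗ g.1.toLinearMap := LinearMap.ext h4
    have e' := congrArg (baseChange f) e
    rw [baseChange_comp, baseChange_comp] at e'
    exact LinearMap.congr_fun e' z
  · have e : g.2.2.toLinearMap ∘ₗ L.proj = L'.proj ∘ₗ g.2.1.toLinearMap := LinearMap.ext h5
    have e' := congrArg (baseChange f) e
    rw [baseChange_comp, baseChange_comp] at e'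
    exact LinearMap.congr_fun e' z

theorem ModuleLift.map_id {R : ArtAlg k} (L : ModuleLift A E R) :
    L.map (AlgHom.id k R.carrier) = L :=
  ModuleLift.ext (AlgHom.ext fun a => baseChange_id (L.act a))

theorem ModuleLift.map_map {R S T : ArtAlg k} (f : R.carrier →ₐ[k] S.carrier)
    (g : S.carrier →ₐ[k] T.carrier) (L : ModuleLift A E R) :
    L.map (g.comp f) = (L.map f).map g :=
  ModuleLift.ext (AlgHom.ext fun a => baseChange_baseChange f g (L.act a))

variable (k ι π) in
/-- The deformation functor `Def_ξ` of the sequence `ξ : M → E → N`. -/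
noncomputable def defSeq : ArtAlg k ⥤ Type u where
  obj R := Quotient (SeqLift.setoid (k := k) ι π R)
  map {R S} f := ↾(Quotient.map (sa := SeqLift.setoid ι π R) (sb := SeqLift.setoid ι π S)
    (SeqLift.map (ArtAlg.toAlgHom f)) (SeqLift.map_equiv _))
  map_id R := by
    ext x
    induction x using Quotient.inductionOn with
    | h L =>
      exact congrArg _ (SeqLift.ext L.sub.map_id L.mid.map_id L.quot.map_id
        (baseChange_id _) (baseChange_id _))
  map_comp f g := by
    ext x
    induction x using Quotient.inductionOn with
    | h L =>
      exact congrArg _ (SeqLift.ext (L.sub.map_map _ _) (L.mid.map_map _ _) (L.quot.map_map _ _)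
        (baseChange_baseChange _ _ _) (baseChange_baseChange _ _ _))

variable (k ι π) in
/-- The forgetful morphism `Def_ξ ⟶ Def_E`. -/
noncomputable def forgetSeq : defSeq k ι π ⟶ defModule k A E where
  app R := ↾(Quotient.map (sa := SeqLift.setoid ι π R) (sb := ModuleLift.setoid A E R)
    SeqLift.mid (fun _ _ ⟨_, h⟩ => ⟨_, h.2.1⟩))
  naturality R S f := by
    ext x
    induction x using Quotient.inductionOn with
    | h L => rfl

variable (k ι π) in
/-- A map `ξ̃ : H(E) → H(ξ)` of formal moduli that is not a monomorphism on the tangent level: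
formal moduli `H(E)` and `H(ξ)` of `Def_E` and `Def_ξ`, and a map `H(E) → H(ξ)` inducing the
forgetful morphism `Def_ξ ⟶ Def_E`, such that `𝔪/𝔪²` of `H(E)` does not inject into `𝔪/𝔪²` of
`H(ξ)`. (The formal moduli exist, and the induced map of the spaces `𝔪/𝔪²` does not depend on the
choices, up to isomorphism.) -/
def NotMonoOnTangents : Prop :=
  ∃ (HE : FormalModuli (defModule k A E)) (Hξ : FormalModuli (defSeq k ι π))
    (h : HE.alg.carrier →ₐ[k] Hξ.alg.carrier),
    FormalAlg.homFunctorMap h ≫ HE.family = Hξ.family ≫ forgetSeq k ι π ∧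
      ¬ Function.Injective (FormalAlg.cotangentMap h)

end Seq

/-! ### Smooth completion points -/

/-- A module is indecomposable if it is nonzero and is not the direct sum of two nonzero
submodules. -/
def IsIndecomposable (A E : Type u) [Ring A] [AddCommGroup E] [Module A E] : Prop :=
  Nontrivial E ∧ ∀ P Q : Submodule A E, IsCompl P Q → P = ⊥ ∨ Q = ⊥

/-- An `n`-dimensional indecomposable `A`-module `E` with `End_A(E) ≃ k` is a smooth completion
point of `Simp_n(A)` if for every non-split short exact sequence `ξ : 0 → M → E → N → 0` the map
`H(E) → H(ξ)` is not a monomorphism on the tangent level. -/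
structure IsSmoothCompletionPoint (k : Type u) [Field k] (A : Type u) [Ring A] [Algebra k A]
    (n : ℕ) (E : Type u) [AddCommGroup E] [Module k E] [Module A E] [IsScalarTower k A E] :
    Prop where
  finite : FiniteDimensional k E
  finrank_eq : Module.finrank k E = n
  indecomposable : IsIndecomposable A E
  end_eq : Nonempty (Module.End A E ≃ₐ[k] k)
  not_mono : ∀ (M N : Type u) [AddCommGroup M] [Module k M] [Module A M] [IsScalarTower k A M]
    [AddCommGroup N] [Module k N] [Module A N] [IsScalarTower k A N]
    (ι : M →ₗ[A] E) (π : E →ₗ[A] N),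
    Function.Injective ι → Function.Exact ι π → Function.Surjective π →
    (¬ ∃ s : N →ₗ[A] E, π ∘ₗ s = LinearMap.id) → NotMonoOnTangents k ι π

/-! ### Extension graphs -/

/-- The extension graph of a family of modules: there is an arrow `i → j` if and only if
`Ext¹_A(V i, V j) ≠ 0`. -/
def extGraph {A : Type u} [Ring A] {I : Type} (V : I → ModuleCat.{u} A) : Digraph I where
  Adj i j := Nontrivial (Abelian.Ext (V i) (V j) 1)

/-- A digraph has a complete cycle if there is a directed path starting and ending at the same
vertex and containing all the vertices. (As usual, a vertex alone is a path of length `0`.) -/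
def HasCompleteCycle {I : Type} (G : Digraph I) : Prop :=
  ∃ (m : ℕ) (w : ℕ → I), w 0 = w m ∧ (∀ i < m, G.Adj (w i) (w (i + 1))) ∧
    ∀ v, ∃ i ≤ m, w i = v

/-- The `i`-th factor `E_{i+1} / E_i` of a chain of submodules of `E`. -/
def factor {A E : Type u} [Ring A] [AddCommGroup E] [Module A E]
    (s : CompositionSeries (Submodule A E)) (i : Fin s.length) : ModuleCat.{u} A :=
  ModuleCat.of A (s i.succ ⧸ (s i.castSucc).submoduleOf (s i.succ))

end Completion

/-!
The tangent map of the forgetful morphism controls extensions between the two ends of a short exact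
sequence `0 → M → E → N → 0`. A lifting of `E` to the dual numbers is a derivation
`δ : A → End_k(E)`, and the only obstruction to lifting the whole sequence along with it is the
class in `Ext¹(M, N)` of the derivation `a ↦ π ∘ δ a ∘ ι`. If `Ext¹(M, N) = 0`, this derivation is
inner, so an automorphism `1 - εΦ` of `k[ε] ⊗ E` turns `δ` into a derivation that preserves `M`
(`ModuleLift.exists_seqLift_of_extVanishes`). The tangent map is then surjective, and dually the map
`𝔪/𝔪²` is injective (`not_notMonoOnTangents`). Hence at a smooth completion point
`Ext¹(P, E/P) ≠ 0` for every submodule `P` different from `0` and `E`: such a sequence never splits,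
as `E` is indecomposable.

Suppose some vertex `w` of the extension graph cannot be reached from a vertex `v`. Let `S` be the
set of vertices reachable from `v`; no arrow leads from `S` to its complement. Wherever a factor
in `S` lies directly above one outside `S` the extension splits, so the composition series can be
rearranged so that the factors in `S` come first. This yields a submodule `P` whose factors are
those in `S`, such that the factors of `E/P` are the others
(`exists_submodule_extVanishes`). By the long exact sequences `Ext¹(P, E/P) = 0`, and `P` is neither
`0` nor `E`, a contradiction. So every vertex can be reached from every other, and joining
paths gives a complete cycle.
-/

namespace Completion

/-! ### Vanishing of `Ext¹` -/

/-- `Ext¹_A(X, Y) = 0`. -/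
def ExtVanishes (A : Type u) [Ring A] (X Y : Type u) [AddCommGroup X] [Module A X]
    [AddCommGroup Y] [Module A Y] : Prop :=
  Subsingleton (Abelian.Ext (ModuleCat.of A X) (ModuleCat.of A Y) 1)

section Ext

variable {A : Type u} [Ring A] {X Y Z W : Type u} [AddCommGroup X] [Module A X]
  [AddCommGroup Y] [Module A Y] [AddCommGroup Z] [Module A Z] [AddCommGroup W] [Module A W]

theorem shortExact_of_linearMap {f : X →ₗ[A] Y} {g : Y →ₗ[A] Z} (hf : Function.Injective f)
    (hfg : Function.Exact f g) (hg : Function.Surjective g) :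
    (ShortComplex.mk (ModuleCat.ofHom f) (ModuleCat.ofHom g)
      (by ext x; exact (hfg _).2 ⟨x, rfl⟩)).ShortExact where
  exact := (ShortComplex.ShortExact.moduleCat_exact_iff_function_exact _).2 hfg
  mono_f := (ModuleCat.mono_iff_injective _).2 hf
  epi_g := (ModuleCat.epi_iff_surjective _).2 hg

theorem ExtVanishes.of_exact_left {f : X →ₗ[A] Y} {g : Y →ₗ[A] Z} (hf : Function.Injective f)
    (hfg : Function.Exact f g) (hg : Function.Surjective g) (hX : ExtVanishes A X W)
    (hZ : ExtVanishes A Z W) : ExtVanishes A Y W := by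
  unfold ExtVanishes at *
  refine subsingleton_of_forall_eq 0 fun x => ?_
  obtain ⟨y, rfl⟩ := Abelian.Ext.contravariant_sequence_exact₂ (shortExact_of_linearMap hf hfg hg) _
    x (Subsingleton.elim (h := hX) _ _)
  rw [Subsingleton.elim (h := hZ) y 0]
  exact Abelian.Ext.comp_zero _ _ _ _ _

theorem ExtVanishes.of_exact_right {f : X →ₗ[A] Y} {g : Y →ₗ[A] Z} (hf : Function.Injective f)
    (hfg : Function.Exact f g) (hg : Function.Surjective g) (hX : ExtVanishes A W X)
    (hZ : ExtVanishes A W Z) : ExtVanishes A W Y := by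
  unfold ExtVanishes at *
  refine subsingleton_of_forall_eq 0 fun x => ?_
  obtain ⟨y, rfl⟩ := Abelian.Ext.covariant_sequence_exact₂ _ (shortExact_of_linearMap hf hfg hg)
    x (Subsingleton.elim (h := hZ) _ _)
  rw [Subsingleton.elim (h := hX) y 0]
  exact Abelian.Ext.zero_comp (ModuleCat.of A W) 1 _ _ _

theorem ExtVanishes.exists_section {f : X →ₗ[A] Y} {g : Y →ₗ[A] Z} (hf : Function.Injective f)
    (hfg : Function.Exact f g) (hg : Function.Surjective g) (h : ExtVanishes A Z X) :
    ∃ s : Z →ₗ[A] Y, g ∘ₗ s = LinearMap.id := by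
  obtain ⟨y, hy⟩ := Abelian.Ext.covariant_sequence_exact₃ _ (shortExact_of_linearMap hf hfg hg)
    (Abelian.Ext.mk₀ (𝟙 (ModuleCat.of A Z))) (zero_add 1) (Subsingleton.elim (h := h) _ _)
  obtain ⟨s, rfl⟩ := (Abelian.Ext.mk₀_bijective _ _).2 y
  refine ⟨s.hom, ?_⟩
  rw [Abelian.Ext.mk₀_comp_mk₀] at hy
  have := (Abelian.Ext.mk₀_bijective _ _).1 hy
  exact congrArg ModuleCat.Hom.hom this

theorem ExtVanishes.of_subsingleton_left [Subsingleton X] : ExtVanishes A X Y :=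
  subsingleton_of_forall_eq 0 fun x => by
    rw [← Abelian.Ext.mk₀_id_comp x]
    have : 𝟙 (ModuleCat.of A X) = 0 := by ext x; exact Subsingleton.elim (α := X) _ _
    rw [this]; simp

theorem ExtVanishes.of_subsingleton_right [Subsingleton Y] : ExtVanishes A X Y :=
  subsingleton_of_forall_eq 0 fun x => by
    rw [← Abelian.Ext.comp_mk₀_id x]
    have : 𝟙 (ModuleCat.of A Y) = 0 := by ext x; exact Subsingleton.elim (α := Y) _ _
    rw [this]; simp

theorem ExtVanishes.congr_left (e : X ≃ₗ[A] Y) (h : ExtVanishes A X W) : ExtVanishes A Y W :=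
  .of_exact_left (f := e.toLinearMap) (g := (0 : Y →ₗ[A] PUnit.{u + 1})) e.injective
    (fun y => ⟨fun _ => e.surjective y, fun _ => rfl⟩) (fun _ => ⟨0, rfl⟩) h .of_subsingleton_left

theorem ExtVanishes.congr_right (e : X ≃ₗ[A] Y) (h : ExtVanishes A W X) : ExtVanishes A W Y :=
  .of_exact_right (f := e.toLinearMap) (g := (0 : Y →ₗ[A] PUnit.{u + 1})) e.injective
    (fun y => ⟨fun _ => e.surjective y, fun _ => rfl⟩) (fun _ => ⟨0, rfl⟩) h .of_subsingleton_right

end Ext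

/-! ### Tangent vectors and the cotangent space -/

section Tangent
variable {k : Type u} [Field k]

theorem FormalAlg.mem_maximalIdeal_iff (H : FormalAlg k) (x : H.carrier) :
    x ∈ IsLocalRing.maximalIdeal H.carrier ↔ H.point x = 0 := by
  rw [← IsLocalRing.eq_maximalIdeal (RingHom.ker_isMaximal_of_surjective
    (H.point : H.carrier →+* k) fun c => ⟨algebraMap k H.carrier c, by simp⟩)]
  rfl

theorem FormalAlg.sub_point_mem (H : FormalAlg k) (x : H.carrier) :
    x - algebraMap k H.carrier (H.point x) ∈ IsLocalRing.maximalIdeal H.carrier := by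
  simp [H.mem_maximalIdeal_iff]

/-- The map `H → 𝔪/𝔪²`, `x ↦ [x - x(0)]`, where `x(0) ∈ k` is the residue of `x`. -/
noncomputable def FormalAlg.differential (H : FormalAlg k) :
    H.carrier →ₗ[k] (IsLocalRing.maximalIdeal H.carrier).Cotangent :=
  ((IsLocalRing.maximalIdeal H.carrier).toCotangent.restrictScalars k).comp
    ((LinearMap.id - Algebra.linearMap k H.carrier ∘ₗ H.point.toLinearMap).codRestrict
      ((IsLocalRing.maximalIdeal H.carrier).restrictScalars k) H.sub_point_mem)

theorem FormalAlg.differential_apply (H : FormalAlg k) (x : H.carrier) :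
    H.differential x = (IsLocalRing.maximalIdeal H.carrier).toCotangent
      ⟨x - algebraMap k H.carrier (H.point x), H.sub_point_mem x⟩ := rfl

theorem FormalAlg.differential_coe (H : FormalAlg k)
    (x : IsLocalRing.maximalIdeal H.carrier) :
    H.differential x = (IsLocalRing.maximalIdeal H.carrier).toCotangent x := by
  have : H.point x = 0 := (H.mem_maximalIdeal_iff _).1 x.2
  rw [differential_apply]
  congr 1
  exact Subtype.ext (by simp [this])

theorem FormalAlg.differential_mul (H : FormalAlg k) (x y : H.carrier) :
    H.differential (x * y) = H.point x • H.differential y + H.point y • H.differential x := by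
  have h := Ideal.mul_mem_mul (H.sub_point_mem x) (H.sub_point_mem y)
  rw [← pow_two] at h
  rw [← sub_eq_zero, ← map_smul, ← map_smul, ← map_add, ← map_sub, differential_apply,
    Ideal.toCotangent_eq_zero]
  convert h using 1
  simp [Algebra.smul_def]
  ring

/-- The map `H → k[ε]`, `x ↦ x(0) + f [x - x(0)] ε`, defined by a linear form `f` on `𝔪/𝔪²`. -/
noncomputable def FormalAlg.toDualNumber (H : FormalAlg k)
    (f : (IsLocalRing.maximalIdeal H.carrier).Cotangent →ₗ[k] k) :
    H.carrier →ₐ[k] DualNumber k :=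
  AlgHom.ofLinearMap
    ((TrivSqZeroExt.inlAlgHom k k k).toLinearMap ∘ₗ H.point.toLinearMap +
      TrivSqZeroExt.inrHom k k ∘ₗ f ∘ₗ H.differential)
    (by
      have h : H.differential 1 = 0 := by simpa using H.differential_mul 1 1
      ext <;> simp [h])
    (fun x y => by
      ext
      · simp
      · simp [H.differential_mul, mul_comm])

/-- If every tangent vector `H → k[ε]` factors through `h : H → K`, then `h` is injective on `𝔪/𝔪²`:
a linear form `f` on `𝔪_H/𝔪_H²` factors through the map induced by `h`, so it vanishes on the
kernel of that map. -/
theorem FormalAlg.cotangentMap_injective_of_surjective {H K : FormalAlg k}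
    (h : H.carrier →ₐ[k] K.carrier)
    (hs : ∀ φ : H.carrier →ₐ[k] DualNumber k, ∃ ψ : K.carrier →ₐ[k] DualNumber k,
      ψ.comp h = φ) : Function.Injective (FormalAlg.cotangentMap h) := by
  rw [injective_iff_map_eq_zero]
  intro x hx
  rw [← Module.forall_dual_apply_eq_zero_iff k]
  intro f
  obtain ⟨y, rfl⟩ := Ideal.toCotangent_surjective _ x
  obtain ⟨ψ, hψ⟩ := hs (H.toDualNumber f)
  have hy : h y ∈ IsLocalRing.maximalIdeal K.carrier ^ 2 := by
    simpa [cotangentMap, Ideal.toCotangent_eq_zero] using hx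
  have hm : ∀ z ∈ IsLocalRing.maximalIdeal K.carrier, TrivSqZeroExt.fst (ψ z) = 0 := by
    intro z hz
    rw [K.mem_maximalIdeal_iff] at hz
    rw [← hz, point_unique K.point ((TrivSqZeroExt.fstHom k k k).comp ψ)]
    rfl
  have h2 : ψ (h y) = 0 := by
    rw [pow_two] at hy
    refine Submodule.mul_induction_on hy (fun a ha b hb => ?_) (fun a b ha hb => ?_)
    · ext <;> simp [hm a ha, hm b hb]
    · rw [map_add, ha, hb, add_zero]
  have h3 : H.toDualNumber f y = 0 := by rw [← hψ]; exact h2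
  have h4 := congrArg TrivSqZeroExt.snd h3
  simpa [toDualNumber, H.differential_coe] using h4

end Tangent

/-! ### Dual numbers -/

section DualNumbers
variable {k : Type u} [Field k]

/-- The generator `ε` of the dual numbers, as an element of the artinian algebra
`ArtAlg.dualNumbers k`. -/
def ArtAlg.eps (k : Type u) [Field k] : (ArtAlg.dualNumbers k).carrier :=
  (DualNumber.eps : DualNumber k)

/-- The coefficient of `ε` in a dual number. -/
def ArtAlg.epsCoeff (k : Type u) [Field k] : (ArtAlg.dualNumbers k).carrier →ₗ[k] k :=
  TrivSqZeroExt.sndHom k k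

theorem ArtAlg.eps_mul_eps : eps k * eps k = 0 := DualNumber.eps_mul_eps

theorem ArtAlg.point_eps : (dualNumbers k).point (eps k) = 0 := DualNumber.fst_eps

theorem ArtAlg.epsCoeff_eps : epsCoeff k (eps k) = 1 := DualNumber.snd_eps

theorem ArtAlg.epsCoeff_one : epsCoeff k 1 = 0 :=
  TrivSqZeroExt.snd_one (R := k) (M := k)

theorem ArtAlg.eq_point_add (r : (dualNumbers k).carrier) :
    r = (dualNumbers k).point r • 1 + epsCoeff k r • eps k := by
  refine TrivSqZeroExt.ext (R := k) (M := k) ?_ ?_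
  · change _ = (TrivSqZeroExt.fst r) • 1 + (TrivSqZeroExt.snd r) • (0 : k); simp
  · change _ = (TrivSqZeroExt.fst r) • 0 + (TrivSqZeroExt.snd r) • (1 : k); simp

variable {X : Type u} [AddCommGroup X] [Module k X]

/-- The coefficient `y` in `z = 1 ⊗ x + ε ⊗ y`, for `z` in `k[ε] ⊗ X`. -/
noncomputable def epsPart (X : Type u) [AddCommGroup X] [Module k X] :
    (ArtAlg.dualNumbers k).carrier ⊗[k] X →ₗ[k] X :=
  (TensorProduct.lid k X).toLinearMap ∘ₗ (ArtAlg.epsCoeff k).rTensor X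

theorem eq_reduce_add (z : (ArtAlg.dualNumbers k).carrier ⊗[k] X) :
    z = 1 ⊗ₜ reduce _ X z + ArtAlg.eps k ⊗ₜ epsPart X z := by
  induction z with
  | zero => simp
  | tmul r x =>
    conv_lhs => rw [ArtAlg.eq_point_add r]
    simp [reduce, epsPart, add_tmul, smul_tmul]
  | add a b ha hb =>
    conv_lhs => rw [ha, hb]
    simp only [map_add, tmul_add]
    abel

end DualNumbers

/-! ### Liftings of modules and of sequences -/

section Liftings

variable {k : Type u} [Field k] {A : Type u} [Ring A] [Algebra k A]
  {M E N : Type u}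
  [AddCommGroup M] [Module k M] [Module A M] [IsScalarTower k A M]
  [AddCommGroup E] [Module k E] [Module A E] [IsScalarTower k A E]
  [AddCommGroup N] [Module k N] [Module A N] [IsScalarTower k A N]
  {ι : M →ₗ[A] E} {π : E →ₗ[A] N}

/-- A lifting `L` of `E` extends to a lifting of the sequence as soon as there is a split short
exact sequence of `R`-modules lifting `ι` and `π` whose submodule is stable under the action of
`A`. The actions on the two ends are the induced ones, written with the retraction `r` and the
section `t`. -/
theorem ModuleLift.exists_seqLift {R : ArtAlg k} (L : ModuleLift A E R)
    (hι : Function.Injective ι)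
    (incl : R.carrier ⊗[k] M →ₗ[R.carrier] R.carrier ⊗[k] E)
    (proj : R.carrier ⊗[k] E →ₗ[R.carrier] R.carrier ⊗[k] N)
    (r : R.carrier ⊗[k] E →ₗ[R.carrier] R.carrier ⊗[k] M)
    (t : R.carrier ⊗[k] N →ₗ[R.carrier] R.carrier ⊗[k] E)
    (hr : ∀ z, r (incl z) = z) (ht : ∀ z, proj (t z) = z) (hpi : ∀ z, proj (incl z) = 0)
    (hrt : ∀ z, incl (r z) + t (proj z) = z)
    (hincl : ∀ z, reduce R E (incl z) = ι (reduce R M z))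
    (hproj : ∀ z, reduce R N (proj z) = π (reduce R E z))
    (hstable : ∀ a z, proj (L.act a (incl z)) = 0) :
    ∃ S : SeqLift ι π R, S.mid = L := by
  have hir : ∀ z, proj z = 0 → incl (r z) = z := fun z hz => by
    simpa [hz] using hrt z
  have hinj : Function.Injective incl := Function.LeftInverse.injective hr
  have htp : ∀ a z, proj (L.act a (t (proj z))) = proj (L.act a z) := fun a z => by
    conv_rhs => rw [← hrt z]
    rw [map_add, map_add, hstable, zero_add]
  have hact : ∀ a z, incl (r (L.act a (incl z))) = L.act a (incl z) :=
    fun a z => hir _ (hstable a z)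
  exact ⟨{
    sub :=
      { act := AlgHom.ofLinearMap
          { toFun := fun a => r ∘ₗ L.act a ∘ₗ incl
            map_add' := fun a b => by ext; simp
            map_smul' := fun c a => by ext; simp }
          (by ext; simp [hr])
          (fun a b => LinearMap.ext fun z => hinj (by simp [hact]))
        reduce_act := fun a z => hι (by
          simp only [AlgHom.ofLinearMap_apply, LinearMap.coe_mk, AddHom.coe_mk,
            LinearMap.comp_apply]
          rw [← hincl, hact, L.reduce_act, hincl, map_smul]) }
    mid := L
    quot :=
      { act := AlgHom.ofLinearMap
          { toFun := fun a => proj ∘ₗ L.act a ∘ₗ t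
            map_add' := fun a b => by ext; simp
            map_smul' := fun c a => by ext; simp }
          (by ext; simp [ht])
          (fun a b => LinearMap.ext fun z => by simp [htp])
        reduce_act := fun a z => by
          simp only [AlgHom.ofLinearMap_apply, LinearMap.coe_mk, AddHom.coe_mk,
            LinearMap.comp_apply]
          rw [hproj, L.reduce_act, map_smul, ← hproj, ht] }
    incl := incl
    proj := proj
    incl_act := hact
    proj_act := fun a z => (htp a z).symm
    reduce_incl := hincl
    reduce_proj := hproj
    incl_injective := hinj
    exact := fun z => ⟨fun hz => ⟨_, hir z hz⟩, fun ⟨x, hx⟩ => hx ▸ hpi x⟩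
    proj_surjective := fun z => ⟨_, ht z⟩ }, rfl⟩

/-- The derivation `δ : A → End_k(E)` of a lifting to the dual numbers, given by
`a (1 ⊗ e) = 1 ⊗ a e + ε ⊗ δ(a) e`. -/
noncomputable def ModuleLift.firstOrder (L : ModuleLift A E (ArtAlg.dualNumbers k)) :
    A →ₗ[k] E →ₗ[k] E where
  toFun a := epsPart E ∘ₗ (L.act a).restrictScalars k ∘ₗ TensorProduct.mk k _ E 1
  map_add' a b := by ext; simp
  map_smul' c a := by ext; simp

theorem ModuleLift.act_one_tmul (L : ModuleLift A E (ArtAlg.dualNumbers k)) (a : A) (e : E) :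
    L.act a (1 ⊗ₜ e) = 1 ⊗ₜ (a • e) + ArtAlg.eps k ⊗ₜ L.firstOrder a e := by
  conv_lhs => rw [eq_reduce_add (L.act a (1 ⊗ₜ e)), L.reduce_act]
  simp [reduce, firstOrder]

theorem ModuleLift.act_eps_tmul (L : ModuleLift A E (ArtAlg.dualNumbers k)) (a : A) (e : E) :
    L.act a (ArtAlg.eps k ⊗ₜ e) = ArtAlg.eps k ⊗ₜ (a • e) := by
  have : ArtAlg.eps k ⊗ₜ[k] e = ArtAlg.eps k • ((1 : (ArtAlg.dualNumbers k).carrier) ⊗ₜ[k] e) := by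
    simp [TensorProduct.smul_tmul']
  rw [this, map_smul, L.act_one_tmul]
  simp [TensorProduct.smul_tmul', ArtAlg.eps_mul_eps]

theorem ModuleLift.firstOrder_mul (L : ModuleLift A E (ArtAlg.dualNumbers k)) (a b : A) (e : E) :
    L.firstOrder (a * b) e = a • L.firstOrder b e + L.firstOrder a (b • e) := by
  have h : L.firstOrder (a * b) e = epsPart E (L.act a (L.act b (1 ⊗ₜ e))) := by
    simp [firstOrder]
  rw [h, L.act_one_tmul, map_add, L.act_one_tmul, L.act_eps_tmul]
  simp [epsPart, ArtAlg.epsCoeff_one, ArtAlg.epsCoeff_eps, add_comm]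

/-- The extension of `M` by `N` defined by a derivation `d : A → Hom_k(M, N)`: the group `N × M`
with the action `a (n, m) = (a n + d(a) m, a m)`. It is a type synonym, so that this action does not
clash with the product action; the Leibniz rule is an argument because the module structure
needs it. -/
def TwistedSum (d : A →ₗ[k] M →ₗ[k] N)
    (_ : ∀ a b m, d (a * b) m = a • d b m + d a (b • m)) : Type u := N × M

section
variable (d : A →ₗ[k] M →ₗ[k] N)
  (hd : ∀ a b m, d (a * b) m = a • d b m + d a (b • m))

instance : AddCommGroup (TwistedSum d hd) := inferInstanceAs (AddCommGroup (N × M))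

instance : Module A (TwistedSum d hd) where
  smul a z := ((a • z.1 + d a z.2, a • z.2) : N × M)
  one_smul z := by
    have h : d 1 z.2 = 0 := by simpa using hd 1 1 z.2
    exact Prod.ext (by change (1 : A) • z.1 + d 1 z.2 = z.1; simp [h]) (one_smul A z.2)
  mul_smul a b z := Prod.ext
    (by
      change (a * b) • z.1 + d (a * b) z.2 = a • (b • z.1 + d b z.2) + d a (b • z.2)
      rw [hd, mul_smul, smul_add, add_assoc])
    (mul_smul a b z.2)
  smul_zero a := Prod.ext (by change a • (0 : N) + d a 0 = 0; simp) (smul_zero (A := M) a)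
  smul_add a z w := Prod.ext
    (by
      change a • (z.1 + w.1) + d a (z.2 + w.2) = (a • z.1 + d a z.2) + (a • w.1 + d a w.2)
      rw [smul_add, map_add]; abel)
    (smul_add a z.2 w.2)
  add_smul a b z := Prod.ext
    (by
      change (a + b) • z.1 + d (a + b) z.2 = (a • z.1 + d a z.2) + (b • z.1 + d b z.2)
      rw [add_smul, map_add, LinearMap.add_apply]; abel)
    (add_smul a b z.2)
  zero_smul z := Prod.ext (by change (0 : A) • z.1 + d 0 z.2 = 0; simp) (zero_smul A z.2)

end

/-- If `Ext¹(M, N) = 0`, every derivation `A → Hom_k(M, N)` is inner: a section of the extension it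
defines has the form `m ↦ (φ m, m)`. -/
theorem exists_eq_commutator_of_extVanishes (d : A →ₗ[k] M →ₗ[k] N)
    (hd : ∀ a b m, d (a * b) m = a • d b m + d a (b • m)) (h : ExtVanishes A M N) :
    ∃ φ : M →ₗ[k] N, ∀ a m, d a m = φ (a • m) - a • φ m := by
  let f : N →ₗ[A] TwistedSum d hd :=
    { toFun := fun n => ((n, 0) : N × M)
      map_add' := fun x y => Prod.ext rfl (add_zero (0 : M)).symm
      map_smul' := fun a x => Prod.ext
        (by change a • x = a • x + d a 0; simp) (smul_zero a).symm }
  let g : TwistedSum d hd →ₗ[A] M :=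
    { toFun := fun z => z.2
      map_add' := fun _ _ => rfl
      map_smul' := fun _ _ => rfl }
  obtain ⟨s, hs⟩ := h.exists_section (f := f) (g := g) (fun x y hxy => congrArg Prod.fst hxy)
    (fun z => ⟨fun hz => ⟨z.1, Prod.ext rfl hz.symm⟩, fun ⟨x, hx⟩ => hx ▸ rfl⟩)
    (fun m => ⟨((0, m) : N × M), rfl⟩)
  have hs2 : ∀ m, (s m).2 = m := fun m => LinearMap.congr_fun hs m
  have key : ∀ (a : A) m, (s (a • m)).1 = a • (s m).1 + d a m := fun a m => by
    conv_rhs => rw [← hs2 m]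
    rw [map_smul, hs2]
    change a • (s m).1 + d a (s m).2 = _
    rw [hs2]
  have hk : ∀ (c : k) m, d (algebraMap k A c) m = 0 := fun c m => by
    have h1 : d 1 m = 0 := by simpa using hd 1 1 m
    rw [Algebra.algebraMap_eq_smul_one, map_smul, LinearMap.smul_apply, h1, smul_zero]
  refine ⟨{ toFun := fun m => (s m).1
            map_add' := fun x y => by rw [map_add]; rfl
            map_smul' := fun c m => ?_ }, fun a m => ?_⟩
  · have := key (algebraMap k A c) m
    rwa [hk, add_zero, algebraMap_smul, algebraMap_smul] at this
  · change d a m = (s (a • m)).1 - a • (s m).1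
    rw [key, add_sub_cancel_left]

theorem baseChange_reduce {R : ArtAlg k} (f : M →ₗ[k] N) (z : R.carrier ⊗[k] M) :
    reduce R N (f.baseChange R.carrier z) = f (reduce R M z) := by
  induction z with
  | zero => simp
  | tmul r x => simp [reduce]
  | add a b ha hb => simp [ha, hb]

variable {ι : M →ₗ[A] E} {π : E →ₗ[A] N}

/-- If `Ext¹(M, N) = 0`, every lifting of `E` to the dual numbers underlies a lifting of the
sequence. -/
theorem ModuleLift.exists_seqLift_of_extVanishes (hι : Function.Injective ι)
    (hιπ : Function.Exact ι π) (hπ : Function.Surjective π) (h : ExtVanishes A M N)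
    (L : ModuleLift A E (ArtAlg.dualNumbers k)) :
    ∃ S : SeqLift ι π (ArtAlg.dualNumbers k), S.mid = L := by
  obtain ⟨φ, hφ⟩ := exists_eq_commutator_of_extVanishes (k := k)
    ((LinearMap.llcomp k M E N (π.restrictScalars k)) ∘ₗ
      (LinearMap.lcomp k E (ι.restrictScalars k)) ∘ₗ L.firstOrder)
    (fun a b m => by simp [L.firstOrder_mul]) h
  replace hφ : ∀ a m, π (L.firstOrder a (ι m)) = φ (a • m) - a • φ m := hφ
  obtain ⟨σ, hσ⟩ := (π.restrictScalars k).exists_rightInverse_of_surjective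
    (LinearMap.range_eq_top.2 hπ)
  replace hσ : ∀ n, π (σ n) = n := fun n => LinearMap.congr_fun hσ n
  have hex : ∀ e, ∃ m, ι m = e - σ (π e) := fun e => (hιπ _).1 (by simp [hσ])
  choose ρ₀ hρ₀ using hex
  let ρ : E →ₗ[k] M :=
    { toFun := ρ₀
      map_add' := fun a b => hι (by simp only [hρ₀, map_add]; abel)
      map_smul' := fun c a => hι (by
        have h1 : ∀ x : M, ι (c • x) = c • ι x := (ι.restrictScalars k).map_smul c
        have h2 : ∀ x : E, π (c • x) = c • π x := (π.restrictScalars k).map_smul c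
        simp only [RingHom.id_apply, h1, hρ₀, h2, map_smul, smul_sub]) }
  have hρ : ∀ e, ι (ρ e) = e - σ (π e) := hρ₀
  have hρι : ∀ m, ρ (ι m) = m := fun m => hι (by
    rw [hρ, (hιπ (ι m)).2 ⟨m, rfl⟩, map_zero, sub_zero])
  -- An extension of `φ` to `E` along the linear splittings. The lifted sequence is `R ⊗ ξ`
  -- transported by the automorphism `1 + εΦ`, whose inverse is `1 - εΦ` as `ε² = 0`.
  let Φ : E →ₗ[k] E := σ ∘ₗ φ ∘ₗ ρ
  have hΦ : ∀ m, π (Φ (ι m)) = φ m := fun m => by simp [Φ, hσ, hρι]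
  let R := (ArtAlg.dualNumbers k).carrier
  let Ψ : R ⊗[k] E →ₗ[R] R ⊗[k] E := ArtAlg.eps k • Φ.baseChange R
  have hΨ : ∀ z, Ψ (Ψ z) = 0 := fun z => by
    simp only [Ψ, LinearMap.smul_apply, map_smul, smul_smul, ArtAlg.eps_mul_eps, zero_smul]
  have hΨr : ∀ z, reduce _ E (Ψ z) = 0 := fun z => by
    refine (reduce_smul _ _ _).trans ?_
    rw [ArtAlg.point_eps, zero_smul]
  let I := (ι.restrictScalars k).baseChange R
  let P := (π.restrictScalars k).baseChange R
  have hrI : ∀ z, ρ.baseChange R (I z) = z := fun z => by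
    rw [← LinearMap.comp_apply, ← LinearMap.baseChange_comp,
      show ρ ∘ₗ ι.restrictScalars k = LinearMap.id from LinearMap.ext hρι]
    simp
  have hPs : ∀ z, P (σ.baseChange R z) = z := fun z => by
    rw [← LinearMap.comp_apply, ← LinearMap.baseChange_comp,
      show π.restrictScalars k ∘ₗ σ = LinearMap.id from LinearMap.ext hσ]
    simp
  have hPI : ∀ z, P (I z) = 0 := fun z => by
    rw [← LinearMap.comp_apply, ← LinearMap.baseChange_comp,
      show π.restrictScalars k ∘ₗ ι.restrictScalars k = 0 from
        LinearMap.ext fun m => (hιπ _).2 ⟨m, rfl⟩]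
    simp
  have hIP : ∀ z, I (ρ.baseChange R z) + σ.baseChange R (P z) = z := fun z => by
    induction z with
    | zero => simp
    | tmul r x => simp [I, P, hρ, ← tmul_add]
    | add a b ha hb =>
      conv_rhs => rw [← ha, ← hb]
      simp only [map_add]
      abel
  refine L.exists_seqLift hι ((LinearMap.id + Ψ) ∘ₗ I) (P ∘ₗ (LinearMap.id - Ψ))
    (ρ.baseChange R ∘ₗ (LinearMap.id - Ψ)) ((LinearMap.id + Ψ) ∘ₗ σ.baseChange R)
    (fun z => ?_) (fun z => ?_) (fun z => ?_) (fun z => ?_) (fun z => ?_) (fun z => ?_)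
    (fun a z => ?_)
  · simp [hΨ, hrI]
  · simp [hΨ, hPs]
  · simp [hΨ, hPI]
  · simp only [LinearMap.comp_apply]
    rw [← map_add, hIP]
    simp [hΨ]
  · simp only [LinearMap.comp_apply, LinearMap.add_apply, map_add, hΨr, add_zero]
    exact baseChange_reduce _ _
  · simp only [LinearMap.comp_apply, LinearMap.sub_apply]
    refine (baseChange_reduce _ _).trans ?_
    simp [hΨr]
  · -- On `1 ⊗ m` the coefficient of `ε` is `π δ(a) ι m + a φ m - φ (a m)`, which vanishes by the
    -- choice of `φ`.
    suffices hT : (P ∘ₗ (LinearMap.id - Ψ)) ∘ₗ L.act a ∘ₗ (LinearMap.id + Ψ) ∘ₗ I = 0 from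
      LinearMap.congr_fun hT z
    apply TensorProduct.AlgebraTensorModule.curry_injective
    ext m
    have hΨ1 : ∀ e : E, Ψ ((1 : R) ⊗ₜ[k] e) = ArtAlg.eps k ⊗ₜ Φ e := fun e => by
      simp [Ψ, TensorProduct.smul_tmul', R]
    have hΨe : ∀ e : E, Ψ (ArtAlg.eps k ⊗ₜ[k] e) = 0 := fun e => by
      simp [Ψ, TensorProduct.smul_tmul', ArtAlg.eps_mul_eps]
    have hP : ∀ (r : R) (e : E), P (r ⊗ₜ[k] e) = r ⊗ₜ π e := fun r e => rfl
    have hI : I ((1 : R) ⊗ₜ[k] m) = 1 ⊗ₜ ι m := rfl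
    have h0 : π (ι (a • m)) = 0 := (hιπ _).2 ⟨_, rfl⟩
    change P ((LinearMap.id - Ψ : R ⊗[k] E →ₗ[R] R ⊗[k] E)
      (L.act a ((LinearMap.id + Ψ : R ⊗[k] E →ₗ[R] R ⊗[k] E) (I ((1 : R) ⊗ₜ[k] m))))) = 0
    rw [hI, LinearMap.add_apply, LinearMap.id_apply, hΨ1, map_add, L.act_one_tmul, L.act_eps_tmul,
      ← map_smul ι, LinearMap.sub_apply, LinearMap.id_apply, map_add Ψ, map_add Ψ, hΨ1, hΨe, hΨe,
      map_sub, map_add, map_add, map_add, map_add, hP, hP, hP, hP, hΦ,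
      map_smul π a (Φ (ι m)), hΦ, h0, hφ, map_zero P]
    simp [tmul_sub]

/-- If `Ext¹(M, N) = 0`, the map `𝔪/𝔪² → 𝔪/𝔪²` from `H(E)` to `H(ξ)` is injective, for all choices
of the formal moduli and of the map between them. -/
theorem not_notMonoOnTangents (hι : Function.Injective ι) (hιπ : Function.Exact ι π)
    (hπ : Function.Surjective π) (h : ExtVanishes A M N) : ¬ NotMonoOnTangents k ι π := by
  rintro ⟨HE, Hξ, u, hu, hnot⟩
  refine hnot (FormalAlg.cotangentMap_injective_of_surjective u fun φ => ?_)
  have hforget : ∀ d : (defModule k A E).obj (ArtAlg.dualNumbers k),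
      ∃ d' : (defSeq k ι π).obj (ArtAlg.dualNumbers k),
        (forgetSeq k ι π).app (ArtAlg.dualNumbers k) d' = d := by
    intro d
    induction d using Quotient.inductionOn with
    | h L =>
      obtain ⟨S, rfl⟩ := ModuleLift.exists_seqLift_of_extVanishes hι hιπ hπ h L
      exact ⟨Quotient.mk _ S, rfl⟩
  obtain ⟨d', hd'⟩ := hforget (HE.family.app (ArtAlg.dualNumbers k) φ)
  obtain ⟨ψ, hψ⟩ := Hξ.tangent.2 d'
  refine ⟨ψ, HE.tangent.1 ?_⟩
  have := congrArg (fun η => η.app (ArtAlg.dualNumbers k) ψ) hu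
  refine Eq.trans ?_ hd'
  rw [← hψ]
  exact this

end Liftings

/-! ### Subquotients and rearrangement of a composition series -/

section Subquotients

variable {A E : Type u} [Ring A] [AddCommGroup E] [Module A E]

/-- The subquotient `X / (X ⊓ Y)`, that is `X / Y` if `Y ≤ X`. -/
abbrev subquotient (X Y : Submodule A E) : Type u := X ⧸ Y.submoduleOf X

theorem subquotient_mk_eq_zero {X : Submodule A E} (Y : Submodule A E) (x : X) :
    (Submodule.Quotient.mk x : subquotient X Y) = 0 ↔ (x : E) ∈ Y :=
  Submodule.Quotient.mk_eq_zero _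

/-- The inclusion `Y / Z → X / Z` for `Y ≤ X`. -/
def subquotientIncl {X Y : Submodule A E} (Z : Submodule A E) (h : Y ≤ X) :
    subquotient Y Z →ₗ[A] subquotient X Z :=
  Submodule.mapQ _ _ (Submodule.inclusion h) fun _ hx => hx

/-- The projection `X / Z → X / Y` for `Z ≤ Y`. -/
def subquotientProj (X : Submodule A E) {Y Z : Submodule A E} (h : Z ≤ Y) :
    subquotient X Z →ₗ[A] subquotient X Y :=
  Submodule.mapQ _ _ LinearMap.id fun _ hx => h hx

theorem subquotientIncl_injective {X Y : Submodule A E} (Z : Submodule A E) (h : Y ≤ X) :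
    Function.Injective (subquotientIncl Z h) := by
  rw [← LinearMap.ker_eq_bot, LinearMap.ker_eq_bot']
  intro x hx
  obtain ⟨x, rfl⟩ := Submodule.Quotient.mk_surjective _ x
  exact (subquotient_mk_eq_zero Z x).2 ((subquotient_mk_eq_zero Z (Submodule.inclusion h x)).1 hx)

theorem subquotientProj_surjective (X : Submodule A E) {Y Z : Submodule A E} (h : Z ≤ Y) :
    Function.Surjective (subquotientProj X h) := by
  intro x
  obtain ⟨x, rfl⟩ := Submodule.Quotient.mk_surjective _ x
  exact ⟨Submodule.Quotient.mk x, rfl⟩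

theorem subquotient_exact {X Y Z : Submodule A E} (hZY : Z ≤ Y) (hYX : Y ≤ X) :
    Function.Exact (subquotientIncl Z hYX) (subquotientProj X hZY) := by
  intro x
  obtain ⟨x, rfl⟩ := Submodule.Quotient.mk_surjective _ x
  refine ⟨fun hx => ?_, ?_⟩
  · exact ⟨Submodule.Quotient.mk ⟨x, (subquotient_mk_eq_zero Y x).1 hx⟩, rfl⟩
  · rintro ⟨y, hy⟩
    obtain ⟨y, rfl⟩ := Submodule.Quotient.mk_surjective _ y
    rw [← hy]
    exact (Submodule.Quotient.mk_eq_zero _).2 y.2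

theorem subsingleton_subquotient_self (X : Submodule A E) : Subsingleton (subquotient X X) := by
  rw [Submodule.Quotient.subsingleton_iff, Submodule.submoduleOf_self]

theorem nonempty_subquotient_equiv {X Y U W : Submodule A E} (hW : X ⊓ Y = W) (hU : X ⊔ Y = U) :
    Nonempty (subquotient X W ≃ₗ[A] subquotient U Y) := by
  subst hW hU
  exact ⟨LinearMap.quotientInfEquivSupQuotient X Y⟩

/-- If `Ext¹(U/X, X/P) = 0`, then `X/P` has a complement in `U/P`. -/
theorem exists_relative_complement {P X U : Submodule A E} (hPX : P ≤ X) (hXU : X ≤ U)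
    (h : ExtVanishes A (subquotient U X) (subquotient X P)) :
    ∃ Q : Submodule A E, Q ⊓ X = P ∧ Q ⊔ X = U := by
  obtain ⟨t, ht⟩ := h.exists_section (subquotientIncl_injective P hXU)
    (subquotient_exact hPX hXU) (subquotientProj_surjective U hPX)
  replace ht : ∀ q, subquotientProj U hPX (t q) = q := fun q => LinearMap.congr_fun ht q
  refine ⟨((LinearMap.range t).comap (Submodule.mkQ _)).map U.subtype, le_antisymm ?_ ?_,
    le_antisymm ?_ ?_⟩
  · rintro x ⟨⟨y, ⟨q, hq⟩, rfl⟩, hx⟩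
    have h1 : subquotientProj U hPX (Submodule.Quotient.mk y) = 0 :=
      (Submodule.Quotient.mk_eq_zero _).2 hx
    have h2 := ht q
    rw [hq] at h2
    have h3 : q = 0 := h2.symm.trans h1
    rw [h3, map_zero] at hq
    exact (subquotient_mk_eq_zero P y).1 hq.symm
  · intro x hx
    refine ⟨⟨⟨x, hXU (hPX hx)⟩, ⟨0, ?_⟩, rfl⟩, hPX hx⟩
    rw [map_zero]
    exact ((subquotient_mk_eq_zero P (⟨x, hXU (hPX hx)⟩ : U)).2 hx).symm
  · refine sup_le ?_ hXU
    rintro x ⟨y, -, rfl⟩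
    exact y.2
  · intro x hx
    obtain ⟨y, hy⟩ := Submodule.Quotient.mk_surjective _
      (t (subquotientProj U hPX (Submodule.Quotient.mk ⟨x, hx⟩)))
    rw [Submodule.mem_sup]
    refine ⟨y, ⟨y, ⟨_, hy.symm⟩, rfl⟩, x - y, ?_, by simp⟩
    have h1 := ht (subquotientProj U hPX (Submodule.Quotient.mk ⟨x, hx⟩))
    rw [← hy, eq_comm] at h1
    exact (Submodule.Quotient.eq (X.submoduleOf U)).1 h1

/-- If no arrow of the extension graph leads from `S` to its complement, and both are nonempty, the
factors in `S` can be moved to the bottom, which gives a proper nonzero submodule `P` with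
`Ext¹(P, E/P) = 0`. -/
theorem exists_submodule_extVanishes (s : CompositionSeries (Submodule A E)) (hs₀ : s.head = ⊥)
    (hs₁ : s.last = ⊤) (S : Set (Fin s.length)) (hS : S.Nonempty) (hS' : Sᶜ.Nonempty)
    (h : ∀ i ∈ S, ∀ j ∉ S, ExtVanishes A (subquotient (s i.succ) (s i.castSucc))
      (subquotient (s j.succ) (s j.castSucc))) :
    ∃ P : Submodule A E, P ≠ ⊥ ∧ P ≠ ⊤ ∧ ExtVanishes A P (E ⧸ P) := by
  -- `P` is the part of `s i` with factors in `S`. That it has such factors, and that `s i / P` has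
  -- the others, enters only through vanishing of `Ext¹`, which passes to extensions. The last two
  -- clauses say that `P` is nonzero (proper) once a factor in `S` (outside `S`) has occurred.
  suffices key : ∀ i : Fin (s.length + 1), ∃ P ≤ s i,
      (∀ (Y : Type u) [AddCommGroup Y] [Module A Y],
        (∀ j ∈ S, ExtVanishes A (subquotient (s j.succ) (s j.castSucc)) Y) →
          ExtVanishes A (subquotient P ⊥) Y) ∧
      (∀ j ∈ S, ExtVanishes A (subquotient (s j.succ) (s j.castSucc)) (subquotient (s i) P)) ∧
      (∀ j ∈ S, j.castSucc < i → P ≠ ⊥) ∧ ∀ j ∉ S, j.castSucc < i → P ≠ s i by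
    obtain ⟨P, -, h1, h2, h3, h4⟩ := key (Fin.last _)
    obtain ⟨a, ha⟩ := hS
    obtain ⟨b, hb⟩ := hS'
    have htop : s (Fin.last _) = ⊤ := hs₁
    rw [htop] at h4
    have e₁ : subquotient P ⊥ ≃ₗ[A] P :=
      Submodule.quotEquivOfEqBot _ (by simp [Submodule.submoduleOf])
    have e₂ : subquotient (s (Fin.last _)) P ≃ₗ[A] (E ⧸ P) := by
      rw [htop]
      exact Submodule.Quotient.equiv _ _ Submodule.topEquiv (by
        ext x; simp [Submodule.submoduleOf])
    exact ⟨P, h3 a ha a.castSucc_lt_last, h4 b hb b.castSucc_lt_last,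
      ((h1 _ h2).congr_left e₁).congr_right e₂⟩
  intro i
  induction i using Fin.induction with
  | zero =>
    have := subsingleton_subquotient_self (⊥ : Submodule A E)
    have hbot : s 0 = ⊥ := hs₀
    rw [hbot]
    exact ⟨⊥, le_rfl, fun Y _ _ _ => .of_subsingleton_left, fun _ _ => .of_subsingleton_right,
      fun j _ hj => absurd hj (Fin.not_lt_zero _), fun j _ hj => absurd hj (Fin.not_lt_zero _)⟩
  | succ i ih =>
    obtain ⟨P, hP, h1, h2, h3, h4⟩ := ih
    have hlt : s i.castSucc < s i.succ := (s.step i).lt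
    have hcases : ∀ j : Fin s.length, j.castSucc < i.succ → j = i ∨ j.castSucc < i.castSucc := by
      intro j hj
      rw [Fin.castSucc_lt_succ_iff] at hj
      exact hj.eq_or_lt
    by_cases hi : i ∈ S
    · -- The top factor splits off from `s i.succ / P`, and `Q / P` is a copy of it.
      obtain ⟨Q, hQ1, hQ2⟩ := exists_relative_complement hP hlt.le (h2 i hi)
      obtain ⟨e₁⟩ := nonempty_subquotient_equiv hQ1 hQ2
      obtain ⟨e₂⟩ := nonempty_subquotient_equiv (inf_comm Q _ ▸ hQ1) (sup_comm Q _ ▸ hQ2)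
      have hPQ : P ≤ Q := hQ1 ▸ inf_le_left
      have hne : Q ≠ ⊥ := by
        rintro rfl
        exact hlt.ne (by simpa using hQ2)
      refine ⟨Q, hQ2 ▸ le_sup_left, fun Y _ _ hY => ?_, fun j hj => (h2 j hj).congr_right e₂,
        fun _ _ _ => hne, fun j hj hji hQ => ?_⟩
      · exact .of_exact_left (subquotientIncl_injective ⊥ hPQ) (subquotient_exact bot_le hPQ)
          (subquotientProj_surjective Q bot_le) (h1 Y hY) ((hY i hi).congr_left e₁.symm)
      · obtain rfl | hji := hcases j hji
        · exact hj hi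
        · exact h4 j hj hji (by rw [← hQ1, hQ, inf_eq_right.2 hlt.le])
    · -- The same `P` serves: the new factor is added to the quotient.
      refine ⟨P, hP.trans hlt.le, h1, fun j hj => ?_, fun j hj hji => ?_,
        fun _ _ _ => (hP.trans_lt hlt).ne⟩
      · exact .of_exact_right (subquotientIncl_injective P hlt.le) (subquotient_exact hP hlt.le)
          (subquotientProj_surjective _ hP) (h2 j hj) (h j hj i hi)
      · obtain rfl | hji := hcases j hji
        · exact absurd hj hi
        · exact h3 j hj hji

end Subquotients

/-! ### The extension graph -/

theorem extGraph_adj_iff {A E : Type u} [Ring A] [AddCommGroup E] [Module A E]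
    (s : CompositionSeries (Submodule A E)) (i j : Fin s.length) :
    (extGraph (factor s)).Adj i j ↔
      ¬ ExtVanishes A (subquotient (s i.succ) (s i.castSucc))
        (subquotient (s j.succ) (s j.castSucc)) :=
  not_subsingleton_iff_nontrivial.symm

theorem hasCompleteCycle_of_reachable {I : Type} [Finite I] [Nonempty I] (G : Digraph I)
    (h : ∀ v w, Relation.ReflTransGen G.Adj v w) : HasCompleteCycle G := by
  classical
  have := Fintype.ofFinite I
  obtain ⟨a⟩ := ‹Nonempty I›
  -- There is a path from `a` to `c` through all the vertices of `F`.
  let Covers (c : I) (F : Finset I) : Prop := ∃ (m : ℕ) (w : ℕ → I), w 0 = a ∧ w m = c ∧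
    (∀ i < m, G.Adj (w i) (w (i + 1))) ∧ ∀ v ∈ F, ∃ i ≤ m, w i = v
  have extend : ∀ F b c, Covers b F → Relation.ReflTransGen G.Adj b c → Covers c F := by
    intro F b c hb hbc
    induction hbc with
    | refl => exact hb
    | @tail d c _ hdc ih =>
      obtain ⟨m, w, h0, hm, hw, hF⟩ := ih
      refine ⟨m + 1, fun i => if i ≤ m then w i else c, by simpa, by simp, fun i hi => ?_,
        fun v hv => ?_⟩
      · rcases Nat.lt_succ_iff_lt_or_eq.1 hi with hi | rfl
        · simpa [hi.le, Nat.succ_le_of_lt hi] using hw i hi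
        · simpa [hm] using hdc
      · obtain ⟨i, hi, rfl⟩ := hF v hv
        exact ⟨i, by omega, by simp [hi]⟩
  have all : ∀ F : Finset I, Covers a F := by
    intro F
    induction F using Finset.induction_on with
    | empty => exact ⟨0, fun _ => a, rfl, rfl, by simp, by simp⟩
    | insert v F _ ih =>
      refine extend _ v a ?_ (h v a)
      obtain ⟨m, w, h0, hm, hw, hF⟩ := extend F a v ih (h a v)
      refine ⟨m, w, h0, hm, hw, fun x hx => ?_⟩
      rcases Finset.mem_insert.1 hx with rfl | hx
      · exact ⟨m, le_rfl, hm⟩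
      · exact hF x hx
  obtain ⟨m, w, h0, hm, hw, hF⟩ := all Finset.univ
  exact ⟨m, w, h0.trans hm.symm, hw, fun v => hF v (Finset.mem_univ v)⟩

theorem IsIndecomposable.not_exists_section {A E : Type u} [Ring A] [AddCommGroup E] [Module A E]
    (hE : IsIndecomposable A E) {P : Submodule A E} (hbot : P ≠ ⊥) (htop : P ≠ ⊤) :
    ¬ ∃ t : (E ⧸ P) →ₗ[A] E, P.mkQ ∘ₗ t = LinearMap.id := by
  rintro ⟨t, ht⟩
  replace ht : ∀ q, P.mkQ (t q) = q := fun q => LinearMap.congr_fun ht q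
  have hc : IsCompl P (LinearMap.range t) := by
    refine ⟨Submodule.disjoint_def.2 ?_, codisjoint_iff.2 (eq_top_iff.2 fun x _ => ?_)⟩
    · rintro _ hx ⟨q, rfl⟩
      have h := ht q
      rw [Submodule.mkQ_apply, (Submodule.Quotient.mk_eq_zero P).2 hx] at h
      rw [← h, map_zero]
    · refine Submodule.mem_sup.2 ⟨x - t (P.mkQ x), ?_, _, ⟨P.mkQ x, rfl⟩, by simp⟩
      rw [← Submodule.Quotient.mk_eq_zero, ← Submodule.mkQ_apply, map_sub, ht, sub_self]
  rcases hE.2 _ _ hc with h | h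
  · exact hbot h
  · refine htop (eq_top_iff.2 fun x _ => (Submodule.Quotient.mk_eq_zero P).1 ?_)
    rw [← Submodule.mkQ_apply, ← ht (P.mkQ x), LinearMap.range_eq_bot.1 h]
    simp

/-- At a smooth completion point the extension graph is strongly connected. -/
theorem IsSmoothCompletionPoint.reachable {k : Type u} [Field k] {A : Type u} [Ring A]
    [Algebra k A] {n : ℕ} {E : Type u} [AddCommGroup E] [Module k E] [Module A E]
    [IsScalarTower k A E] (hE : IsSmoothCompletionPoint k A n E)
    (s : CompositionSeries (Submodule A E)) (hs₀ : s.head = ⊥) (hs₁ : s.last = ⊤)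
    (v w : Fin s.length) : Relation.ReflTransGen (extGraph (Completion.factor s)).Adj v w := by
  by_contra hvw
  obtain ⟨P, hbot, htop, hP⟩ := exists_submodule_extVanishes s hs₀ hs₁
    {x | Relation.ReflTransGen (extGraph (Completion.factor s)).Adj v x} ⟨v, .refl⟩ ⟨w, hvw⟩
    (fun i hi j hj => by
      by_contra hij
      exact hj (Relation.ReflTransGen.tail hi ((extGraph_adj_iff s i j).2 hij)))
  exact not_notMonoOnTangents P.injective_subtype (LinearMap.exact_subtype_mkQ P)
    P.mkQ_surjective hP
    (hE.not_mono P (E ⧸ P) P.subtype P.mkQ P.injective_subtype (LinearMap.exact_subtype_mkQ P)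
      P.mkQ_surjective (hE.indecomposable.not_exists_section hbot htop))

end Completion

theorem theorem6 (k : Type u) [Field k] [IsAlgClosed k] [CharZero k] (A : Type u) [Ring A]
    [Algebra k A] [Algebra.FiniteType k A] (n : ℕ) (E : Type u) [AddCommGroup E] [Module k E]
    [Module A E] [IsScalarTower k A E]
    (hE : Completion.IsSmoothCompletionPoint k A n E)
    (s : CompositionSeries (Submodule A E)) (hs₀ : s.head = ⊥) (hs₁ : s.last = ⊤) :
    Completion.HasCompleteCycle (Completion.extGraph (Completion.factor s)) := by
  -- The series has a factor, as `E` is nonzero.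
  have : Nonempty (Fin s.length) := by
    refine ⟨⟨0, Nat.pos_of_ne_zero fun h0 => ?_⟩⟩
    have := hE.indecomposable.1
    have : s.head = s.last := congrArg s (Fin.ext (by simp [h0]))
    rw [hs₀, hs₁] at this
    exact bot_ne_top this
  exact Completion.hasCompleteCycle_of_reachable _ (hE.reachable s hs₀ hs₁)
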